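/- For a graph $G$ with vertex set $V$ and a configuration ${\bf p}\colon V\to\mathbb R^d$, the framework $(G,{\bf p})$ is \emph{universally rigid} if for every $D$, every ${\bf p}'\colon V\to\mathbb R^D$ with $|{\bf p}'_i-{\bf p}'_j|=|{\bf p}_i-{\bf p}_j|$ for all edges $\{i,j\}$ of $G$ is congruent to ${\bf p}$ (that is, $|{\bf p}'_i-{\bf p}'_j|=|{\bf p}_i-{\bf p}_j|$ for all $i,j\in V$). Regard $\mathbb R^d$ as a coordinate hyperplane of $\mathbb R^{d+1}$. For ${\bf p}_0\in\mathbb R^{d+1}$, the cone ${\bf p}_0*(G,{\bf p})$ is the framework in $\mathbb R^{d+1}$ obtained from $(G,{\bf p})$ by adding a new vertex, placed at ${\bf p}_0$ and joined to all vertices of $G$. Let $(K(n,m),({\bf p},{\bf q}))$ denote the framework of the complete bipartite graph $K(n,m)$ whose two parts are placed at ${\bf p}=({\bf p}_1,\dots,{\bf p}_n)$ and ${\bf q}=({\bf q}_1,\dots,{\bf q}_m)$. Corollary. Let ${\bf p}=({\bf p}_1,\dots,{\bf p}_n)$ and ${\bf q}=({\bf q}_1,\dots,{\bf q}_m)$ be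 configurations in $\mathbb R^d$, each with affine span all of $\mathbb R^d$, and let ${\bf p}_0\in\mathbb R^{d+1}\setminus\mathbb R^d$. If the cone ${\bf p}_0*(K(n,m),({\bf p},{\bf q}))$ is universally rigid, then $(K(n,m),({\bf p},{\bf q}))$ is universally rigid. -/

import Mathlib

/-- A framework `(G, p)` in `ℝ^d` is universally rigid if, for every `D`, every framework
`(G, p')` in `ℝ^D` with the same edge lengths is congruent to `(G, p)`, that is, all pairwise
distances between vertices agree. -/
def UniversallyRigid {V : Type*} {d : ℕ} (G : SimpleGraph V)
    (p : V → EuclideanSpace ℝ (Fin d)) : Prop :=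
  ∀ (D : ℕ) (p' : V → EuclideanSpace ℝ (Fin D)),
    (∀ i j : V, G.Adj i j → dist (p' i) (p' j) = dist (p i) (p j)) → Congruent p' p

/-- The graph obtained from `G` by adding one vertex `none`, adjacent to all vertices of `G`. -/
def coneGraph {V : Type*} (G : SimpleGraph V) : SimpleGraph (Option V) where
  Adj
    | none, none => False
    | none, some _ => True
    | some _, none => True
    | some i, some j => G.Adj i j
  symm := ⟨by
    rintro (_ | i) (_ | j) h
    · exact h
    · trivial
    · trivial
    · exact G.adj_symm h⟩
  loopless := ⟨by
    rintro (_ | i) h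
    · exact h
    · exact G.irrefl h⟩

/-- The standard inclusion of `ℝ^d` in `ℝ^(d+1)`, as the hyperplane where the last coordinate
is zero. -/
def inclSucc {d : ℕ} (x : EuclideanSpace ℝ (Fin d)) : EuclideanSpace ℝ (Fin (d + 1)) :=
  WithLp.toLp 2 (Fin.snoc (α := fun _ => ℝ) (fun i => x i) 0)

/-- The configuration of the cone `p₀ * (G, p)` in `ℝ^(d+1)`, for `p` in `ℝ^d ⊆ ℝ^(d+1)`:
the added vertex is at `p₀`. -/
def coneConfig {V : Type*} {d : ℕ} (p₀ : EuclideanSpace ℝ (Fin (d + 1)))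
    (p : V → EuclideanSpace ℝ (Fin d)) : Option V → EuclideanSpace ℝ (Fin (d + 1))
  | none => p₀
  | some i => inclSucc (p i)

/-! Both frameworks are compared with one condition, `QuadricInseparable`: no quadric separates `p`
from `q`, except trivially. The cone forces it. Seen from the cone point, a quadric becomes a
symmetric operator `X` on `ℝ^(d+1)`, positive along the vectors `u` to `p` and negative along the
vectors `w` to `q` (or zero there). Applying `1 - ε X` to `u` and its inverse to `w` keeps every
product `⟪u i, w j⟫` and lengthens nothing; extra orthogonal coordinates restore the norms. Rigidity
of the cone then fixes the Gram matrix of `u`, which is impossible if `⟪X (w j), w j⟫ < 0`, as `w j`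
is a combination of the `u i` (`apply_eq_zero_of_gram_rigid`). Conversely, any framework with the
same bipartite edge lengths is a pair of dual linear images plus orthogonal errors
(`exists_affine_form_of_dist_eq`). The edge equations yield a separating quadric measuring the
failure of congruence, so it vanishes on all vertices. -/

open Filter Topology

/-! ### Contracting perturbations and Gram rigidity -/

/-- For `ε` small, `1 - ε X` shrinks the vectors `u i`
and its inverse shrinks the vectors `w j`. -/
theorem exists_contracting {ι κ E : Type*} [Finite ι] [Finite κ]
    [NormedAddCommGroup E] [InnerProductSpace ℝ E] [FiniteDimensional ℝ E]
    (u : ι → E) (w : κ → E) (X : E →L[ℝ] E)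
    (hu : ∀ i, 0 < inner ℝ (X (u i)) (u i) ∨ X (u i) = 0)
    (hw : ∀ j, inner ℝ (X (w j)) (w j) < 0 ∨ X (w j) = 0) :
    ∃ ε : ℝ, 0 < ε ∧ ∃ S : E →L[ℝ] E, (∀ x, S x - ε • X (S x) = x) ∧
      (∀ i, ‖u i - ε • X (u i)‖ ≤ ‖u i‖) ∧ ∀ j, ‖S (w j)‖ ≤ ‖w j‖ := by
  have : CompleteSpace E := FiniteDimensional.complete ℝ E
  have hexp : ∀ (ε : ℝ) (x : E), ‖x - ε • X x‖ ^ 2 =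
      ‖x‖ ^ 2 - 2 * ε * inner ℝ (X x) x + ε ^ 2 * ‖X x‖ ^ 2 := by
    intro ε x
    rw [norm_sub_sq_real, real_inner_smul_right, norm_smul, mul_pow, Real.norm_eq_abs, sq_abs,
      real_inner_comm]
    ring
  let T : ℝ → (E →L[ℝ] E) := fun ε => 1 - ε • X
  have hT : Continuous T := by fun_prop
  have hT0 : T 0 = 1 := by simp [T]
  have hunit : ∀ᶠ ε in 𝓝 (0 : ℝ), IsUnit (T ε) := by
    have : {S : E →L[ℝ] E | IsUnit S} ∈ 𝓝 (T 0) :=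
      Units.isOpen.mem_nhds (by rw [hT0]; exact isUnit_one)
    exact hT.continuousAt this
  have hS : Tendsto (fun ε => Ring.inverse (T ε)) (𝓝 0) (𝓝 1) := by
    have h1 := NormedRing.inverse_continuousAt (1 : (E →L[ℝ] E)ˣ)
    have h2 : ContinuousAt (fun S : E →L[ℝ] E => Ring.inverse S) (T 0) := by
      rw [hT0]; exact h1
    have h3 := h2.comp hT.continuousAt
    simpa [ContinuousAt, hT0, Function.comp_def] using h3
  have hev_u : ∀ᶠ ε in 𝓝 (0 : ℝ), ∀ i, X (u i) ≠ 0 →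
      ε * ‖X (u i)‖ ^ 2 < 2 * inner ℝ (X (u i)) (u i) := by
    refine eventually_all.2 fun i => ?_
    by_cases h : X (u i) = 0
    · simp [h]
    have hpos := (hu i).resolve_right h
    have hc : Continuous fun ε : ℝ => ε * ‖X (u i)‖ ^ 2 := by fun_prop
    have := hc.continuousAt.eventually_lt (continuousAt_const (x := (0 : ℝ))
      (y := 2 * inner ℝ (X (u i)) (u i))) (by simpa using hpos)
    filter_upwards [this] with ε hε _ using hε
  -- The sign is needed at `y = (T ε)⁻¹ (w j)`: then `w j = y - ε X y` is at least as long as `y`.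
  have hev_w : ∀ᶠ ε in 𝓝 (0 : ℝ), ∀ j, X (w j) ≠ 0 →
      inner ℝ (X (Ring.inverse (T ε) (w j))) (Ring.inverse (T ε) (w j)) < 0 := by
    refine eventually_all.2 fun j => ?_
    by_cases h : X (w j) = 0
    · simp [h]
    have hneg := (hw j).resolve_right h
    have hc : Continuous fun S : E →L[ℝ] E => inner ℝ (X (S (w j))) (S (w j)) := by fun_prop
    have h2 := (hc.tendsto 1).comp hS
    filter_upwards [h2.eventually_lt_const (by simpa using hneg)] with ε hε _ using hε
  have hall := (hunit.and (hev_u.and hev_w)).filter_mono (nhdsWithin_le_nhds (s := Set.Ioi 0))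
  obtain ⟨ε, ⟨hU, h1, h2⟩, hε⟩ := (hall.and self_mem_nhdsWithin).exists
  have hε : 0 < ε := hε
  have hTS : ∀ x, T ε (Ring.inverse (T ε) x) = x := fun x => by
    rw [← mul_apply_eq_comp, Ring.mul_inverse_cancel _ hU]; simp
  have hST : ∀ x, Ring.inverse (T ε) (T ε x) = x := fun x => by
    rw [← mul_apply_eq_comp, Ring.inverse_mul_cancel _ hU]; simp
  refine ⟨ε, hε, Ring.inverse (T ε), fun x => by simpa [T] using hTS x, fun i => ?_, fun j => ?_⟩
  · by_cases h : X (u i) = 0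
    · simp [h]
    refine le_of_sq_le_sq ?_ (norm_nonneg _)
    rw [hexp]
    nlinarith [h1 i h]
  · by_cases h : X (w j) = 0
    · have hw' : T ε (w j) = w j := by simp [T, h]
      have := hST (w j)
      rw [hw'] at this
      rw [this]
    refine le_of_sq_le_sq ?_ (norm_nonneg _)
    have h3 := hexp ε (Ring.inverse (T ε) (w j))
    have h4 : Ring.inverse (T ε) (w j) - ε • X (Ring.inverse (T ε) (w j)) = w j := by
      simpa [T] using hTS (w j)
    rw [h4] at h3
    nlinarith [h2 j h, mul_pos hε (neg_pos.2 (h2 j h)), mul_nonneg (sq_nonneg ε)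
      (sq_nonneg ‖X (Ring.inverse (T ε) (w j))‖)]

/-- If the vectors `u`, `w` are determined, as far as the Gram matrix of `u` goes, by their norms
and by the mutual inner products between the two families, then a symmetric operator
that is positive along `u` and negative along `w` annihilates each `w j` in the span of `u`. -/
theorem apply_eq_zero_of_gram_rigid {ι κ E : Type} [Fintype ι] [Fintype κ]
    [DecidableEq ι] [DecidableEq κ]
    [NormedAddCommGroup E] [InnerProductSpace ℝ E] [FiniteDimensional ℝ E]
    (u : ι → E) (w : κ → E)
    (hrig : ∀ (F : Type) [NormedAddCommGroup F] [InnerProductSpace ℝ F] [FiniteDimensional ℝ F]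
      (u' : ι → F) (w' : κ → F), (∀ i, ‖u' i‖ = ‖u i‖) → (∀ j, ‖w' j‖ = ‖w j‖) →
      (∀ i j, inner ℝ (u' i) (w' j) = inner ℝ (u i) (w j)) →
      ∀ i k, inner ℝ (u' i) (u' k) = inner ℝ (u i) (u k))
    (X : E →L[ℝ] E) (hX : X.toLinearMap.IsSymmetric)
    (hu : ∀ i, 0 < inner ℝ (X (u i)) (u i) ∨ X (u i) = 0)
    (hw : ∀ j, inner ℝ (X (w j)) (w j) < 0 ∨ X (w j) = 0)
    (j : κ) (a : ι → ℝ) (ha : w j = ∑ i, a i • u i) : X (w j) = 0 := by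
  obtain ⟨ε, hε, S, hS, hTu, hSw⟩ := exists_contracting u w X hu hw
  -- One private coordinate per vector: it makes up the lost norm without affecting the products of
  -- `u'` with `w'`.
  let F := WithLp 2 (E × EuclideanSpace ℝ (ι ⊕ κ))
  let α : ι → ℝ := fun i => √(‖u i‖ ^ 2 - ‖u i - ε • X (u i)‖ ^ 2)
  let β : κ → ℝ := fun j => √(‖w j‖ ^ 2 - ‖S (w j)‖ ^ 2)
  have hα : ∀ i, α i ^ 2 = ‖u i‖ ^ 2 - ‖u i - ε • X (u i)‖ ^ 2 := fun i =>
    Real.sq_sqrt (sub_nonneg.2 (pow_le_pow_left₀ (norm_nonneg _) (hTu i) 2))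
  have hβ : ∀ j, β j ^ 2 = ‖w j‖ ^ 2 - ‖S (w j)‖ ^ 2 := fun j =>
    Real.sq_sqrt (sub_nonneg.2 (pow_le_pow_left₀ (norm_nonneg _) (hSw j) 2))
  let u' : ι → F := fun i =>
    WithLp.toLp 2 (u i - ε • X (u i), EuclideanSpace.single (Sum.inl i) (α i))
  let w' : κ → F := fun j => WithLp.toLp 2 (S (w j), EuclideanSpace.single (Sum.inr j) (β j))
  have hgram := hrig F u' w' (fun i => by
      rw [← sq_eq_sq₀ (norm_nonneg _) (norm_nonneg _), WithLp.prod_norm_sq_eq_of_L2]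
      simp [u', hα]) (fun j => by
      rw [← sq_eq_sq₀ (norm_nonneg _) (norm_nonneg _), WithLp.prod_norm_sq_eq_of_L2]
      simp [w', hβ]) (fun i j => by
      have h1 : inner ℝ (X (u i)) (S (w j)) = inner ℝ (u i) (X (S (w j))) := hX _ _
      have h2 : inner ℝ (u i - ε • X (u i)) (S (w j)) = inner ℝ (u i) (w j) := by
        conv_rhs => rw [← hS (w j)]
        rw [inner_sub_left, inner_sub_right, real_inner_smul_left, real_inner_smul_right, h1]
      rw [WithLp.prod_inner_apply]
      simp [u', w', h2, EuclideanSpace.inner_single_left])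
  -- The Gram matrix fixes this norm, yet the `E`-component is `w j - ε X (w j)`, which is longer
  -- than `w j` if `⟪X (w j), w j⟫ < 0`.
  have hnorm : ‖∑ i, a i • u' i‖ ^ 2 = ‖w j‖ ^ 2 := by
    rw [ha, ← real_inner_self_eq_norm_sq, ← real_inner_self_eq_norm_sq]
    simp only [sum_inner, inner_sum, real_inner_smul_left, real_inner_smul_right, hgram]
  have hfst : (∑ i, a i • u' i).fst = w j - ε • X (w j) := by
    rw [ha, show (∑ i, a i • u' i).fst =
      WithLp.fstₗ (𝕜 := ℝ) 2 (α := E) (β := EuclideanSpace ℝ (ι ⊕ κ)) (∑ i, a i • u' i) from rfl]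
    simp [u', smul_sub, Finset.sum_sub_distrib, Finset.smul_sum, smul_comm ε]
  rw [WithLp.prod_norm_sq_eq_of_L2, hfst, norm_sub_sq_real, real_inner_smul_right, norm_smul,
    real_inner_comm] at hnorm
  refine (hw j).resolve_left fun hneg => ?_
  nlinarith [mul_pos hε (neg_pos.2 hneg), sq_nonneg ‖(∑ i, a i • u' i).snd‖,
    sq_nonneg (‖ε‖ * ‖X (w j)‖)]

/-! ### Normal form of equivalent bipartite configurations -/

theorem two_mul_inner_sub_sub {E : Type*} [NormedAddCommGroup E] [InnerProductSpace ℝ E]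
    (a b c d : E) : 2 * inner ℝ (a - b) (c - d) =
      dist a d ^ 2 + dist b c ^ 2 - dist a c ^ 2 - dist b d ^ 2 := by
  simp only [dist_eq_norm, norm_sub_sq_real, inner_sub_left, inner_sub_right]
  ring

/-- Equivalent bipartite configurations are affinely related up to orthogonal components. -/
theorem exists_affine_form_of_dist_eq {ι κ E F : Type*} [Fintype ι]
    [NormedAddCommGroup E] [InnerProductSpace ℝ E] [FiniteDimensional ℝ E]
    [NormedAddCommGroup F] [InnerProductSpace ℝ F] [FiniteDimensional ℝ F]
    (p : ι → E) (q : κ → E) (hp : affineSpan ℝ (Set.range p) = ⊤)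
    (hq : affineSpan ℝ (Set.range q) = ⊤) (p' : ι → F) (q' : κ → F)
    (hd : ∀ i j, dist (p' i) (q' j) = dist (p i) (q j)) :
    ∃ (B : E →ₗ[ℝ] F) (N : E →ₗ[ℝ] E) (t : E) (o : F) (c : ι → F) (e : κ → F),
      (∀ x y, inner ℝ (B x) (B (N y)) = inner ℝ x y) ∧
      (∀ i, p' i = o + B (p i + t) + c i) ∧ (∀ j, q' j = o + B (N (q j)) + e j) ∧
      (∀ x i, inner ℝ (B x) (c i) = 0) ∧ (∀ x j, inner ℝ (B x) (e j) = 0) ∧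
      ∀ i j, inner ℝ (c i) (e j) = 0 := by
  obtain ⟨i₀⟩ : Nonempty ι := by
    rw [← Set.range_nonempty_iff_nonempty (f := p), ← affineSpan_nonempty (k := ℝ), hp]
    exact Set.univ_nonempty
  obtain ⟨j₀⟩ : Nonempty κ := by
    rw [← Set.range_nonempty_iff_nonempty (f := q), ← affineSpan_nonempty (k := ℝ), hq]
    exact Set.univ_nonempty
  have hpspan : Submodule.span ℝ (Set.range fun i => p i - p i₀) = ⊤ := by
    have := vectorSpan_range_eq_span_range_vsub_right ℝ p i₀
    rw [← direction_affineSpan, hp, AffineSubspace.direction_top] at this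
    simpa using this.symm
  have hqspan : Submodule.span ℝ (Set.range fun j => q j - q j₀) = ⊤ := by
    have := vectorSpan_range_eq_span_range_vsub_right ℝ q j₀
    rw [← direction_affineSpan, hq, AffineSubspace.direction_top] at this
    simpa using this.symm
  have hinner : ∀ i j, inner ℝ (p' i - p' i₀) (q' j - q' j₀) =
      inner ℝ (p i - p i₀) (q j - q j₀) := by
    intro i j
    have h1 := two_mul_inner_sub_sub (p i) (p i₀) (q j) (q j₀)
    have h2 := two_mul_inner_sub_sub (p' i) (p' i₀) (q' j) (q' j₀)
    simp only [hd] at h2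
    linarith
  let W : Submodule ℝ F := Submodule.span ℝ (Set.range fun j => q' j - q' j₀)
  have hWq : ∀ j, q' j - q' j₀ ∈ W := fun j => Submodule.subset_span ⟨j, rfl⟩
  have hW_orth : ∀ x : F, (∀ j, inner ℝ x (q' j - q' j₀) = 0) → ∀ y ∈ W, inner ℝ x y = 0 := by
    intro x hx y hy
    induction hy using Submodule.span_induction with
    | mem y hy => obtain ⟨j, rfl⟩ := hy; exact hx j
    | zero => simp
    | add y z _ _ h1 h2 => rw [inner_add_right, h1, h2, add_zero]
    | smul r y _ h => rw [real_inner_smul_right, h, mul_zero]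
  have hproj : ∀ x : F, ∀ y ∈ W, inner ℝ (W.starProjection x) y = inner ℝ x y := by
    intro x y hy
    have := W.starProjection_inner_eq_zero x y hy
    rw [inner_sub_left] at this
    linarith
  obtain ⟨R, hR⟩ := (Fintype.linearCombination ℝ fun i => p i - p i₀).exists_rightInverse_of_surjective
    (by rw [Fintype.range_linearCombination, hpspan])
  -- The products with the spanning vectors `q' j - q' j₀` determine `B x` within `W`, so the choice
  -- of `R` is immaterial.
  let B : E →ₗ[ℝ] F := W.starProjection.toLinearMap ∘ₗ
    (Fintype.linearCombination ℝ fun i => p' i - p' i₀) ∘ₗ R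
  have hBW : ∀ x, B x ∈ W := fun x => W.starProjection_apply_mem _
  have hBq : ∀ x j, inner ℝ (B x) (q' j - q' j₀) = inner ℝ x (q j - q j₀) := by
    intro x j
    have hx : x = ∑ i, R x i • (p i - p i₀) := by
      have := LinearMap.congr_fun hR x
      simpa [Fintype.linearCombination_apply] using this.symm
    have hBx : B x = W.starProjection (∑ i, R x i • (p' i - p' i₀)) := by
      simp [B, Fintype.linearCombination_apply]
    rw [hBx, hproj _ _ (hWq j)]
    conv_rhs => rw [hx]
    simp only [sum_inner, real_inner_smul_left, hinner]
  have hBinj : ∀ x, B x = 0 → x = 0 := by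
    intro x hx
    have : ∀ y ∈ Submodule.span ℝ (Set.range fun j => q j - q j₀), inner ℝ x y = 0 := by
      intro y hy
      induction hy using Submodule.span_induction with
      | mem y hy => obtain ⟨j, rfl⟩ := hy; rw [← hBq, hx, inner_zero_left]
      | zero => simp
      | add y z _ _ h1 h2 => rw [inner_add_right, h1, h2, add_zero]
      | smul r y _ h => rw [real_inner_smul_right, h, mul_zero]
    exact inner_self_eq_zero.1 (this x (by rw [hqspan]; trivial))
  have hMinj : Function.Injective (B.adjoint ∘ₗ B) := by
    refine (injective_iff_map_eq_zero _).2 fun x hx => hBinj x ?_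
    rw [← inner_self_eq_zero (𝕜 := ℝ), ← LinearMap.adjoint_inner_right]
    simp only [LinearMap.comp_apply] at hx
    rw [hx, inner_zero_right]
  let Me := LinearEquiv.ofInjectiveEndo _ hMinj
  let N : E →ₗ[ℝ] E := Me.symm.toLinearMap
  have hMN : ∀ y, B.adjoint (B (N y)) = y := fun y => Me.apply_symm_apply y
  have hBN : ∀ x y, inner ℝ (B x) (B (N y)) = inner ℝ x y := fun x y => by
    rw [← LinearMap.adjoint_inner_right, hMN]
  -- `B N B*` is the projection onto the range of `B`, so `B (p i₀ + t)` is the projection of `p' i₀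
  -- - o₀`. The part `s` left in `W` goes into the origin, which makes `c i` orthogonal to `W` while
  -- `e j` stays in `W`.
  let o₀ : F := q' j₀ - B (N (q j₀))
  let t : E := N (B.adjoint (p' i₀ - o₀)) - p i₀
  let s : F := W.starProjection (p' i₀ - o₀) - B (p i₀ + t)
  have hsW : s ∈ W := W.sub_mem (W.starProjection_apply_mem _) (hBW _)
  have hsB : ∀ x, inner ℝ (B x) s = 0 := by
    intro x
    have h1 : p i₀ + t = N (B.adjoint (p' i₀ - o₀)) := by simp [t]
    simp only [s]
    rw [inner_sub_right, h1, hBN, LinearMap.adjoint_inner_right, real_inner_comm,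
      hproj _ _ (hBW x), real_inner_comm, sub_self]
  let c : ι → F := fun i => p' i - (o₀ + s) - B (p i + t)
  let e : κ → F := fun j => q' j - (o₀ + s) - B (N (q j))
  have hcW : ∀ i, ∀ y ∈ W, inner ℝ (c i) y = 0 := by
    intro i y hy
    have h1 : c i = ((p' i - p' i₀) - B (p i - p i₀)) +
        ((p' i₀ - o₀) - W.starProjection (p' i₀ - o₀)) := by
      simp only [c, s, map_sub, map_add]
      abel
    rw [h1, inner_add_left, W.starProjection_inner_eq_zero _ y hy, add_zero]
    refine hW_orth _ (fun j => ?_) y hy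
    rw [inner_sub_left, hBq, hinner, sub_self]
  have he : ∀ j, e j = (q' j - q' j₀) - B (N (q j - q j₀)) - s := by
    intro j
    simp only [e, o₀, map_sub]
    abel
  refine ⟨B, N, t, o₀ + s, c, e, hBN, fun i => by simp [c], fun j => by simp [e],
    fun x i => by rw [real_inner_comm]; exact hcW i _ (hBW x), fun x j => ?_,
    fun i j => hcW i _ ?_⟩
  · rw [he, inner_sub_right, inner_sub_right, hBq, hBN, hsB]
    simp
  · rw [he]
    exact W.sub_mem (W.sub_mem (hWq j) (hBW _)) hsW

/-! ### From quadric inseparability to congruence -/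

/-- No nonzero inhomogeneous quadratic form `Q x = ⟪A x, x⟫ + 2 ⟪b, x⟫ + c` separates `p` from `q`,
where a point at which `Q` does not have its strict sign must be a singular point of `Q`. -/
def QuadricInseparable {ι κ E : Type*} [NormedAddCommGroup E] [InnerProductSpace ℝ E]
    (p : ι → E) (q : κ → E) : Prop :=
  ∀ (A : E →ₗ[ℝ] E) (b : E) (c : ℝ), A.IsSymmetric →
    (∀ i, 0 < inner ℝ (A (p i)) (p i) + 2 * inner ℝ b (p i) + c ∨
      A (p i) + b = 0 ∧ inner ℝ b (p i) + c = 0) →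
    (∀ j, inner ℝ (A (q j)) (q j) + 2 * inner ℝ b (q j) + c < 0 ∨
      A (q j) + b = 0 ∧ inner ℝ b (q j) + c = 0) →
    (∀ i, inner ℝ (A (p i)) (p i) + 2 * inner ℝ b (p i) + c = 0) ∧
      ∀ j, inner ℝ (A (q j)) (q j) + 2 * inner ℝ b (q j) + c = 0

/-- The quadric is `Q = g - f + 2 lam`. It equals `r + 2‖γ‖²` on `p` and `-(r + 2‖e‖²)` on `q`, with
`r ≥ 0` vanishing exactly where `N x = x + t`. Its vanishing on the vertices kills the errors and
makes `B` an isometry. -/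
theorem QuadricInseparable.congruent {ι κ E F : Type*} [Fintype ι]
    [NormedAddCommGroup E] [InnerProductSpace ℝ E] [FiniteDimensional ℝ E]
    [NormedAddCommGroup F] [InnerProductSpace ℝ F] [FiniteDimensional ℝ F]
    {p : ι → E} {q : κ → E} (hpq : QuadricInseparable p q)
    (hp : affineSpan ℝ (Set.range p) = ⊤)
    (hq : affineSpan ℝ (Set.range q) = ⊤) {p' : ι → F} {q' : κ → F}
    (hd : ∀ i j, dist (p' i) (q' j) = dist (p i) (q j)) :
    Congruent (Sum.elim p' q') (Sum.elim p q) := by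
  obtain ⟨B, N, t, o, γ, e, hBN, hp', hq', hBc, hBe, hce⟩ :=
    exists_affine_form_of_dist_eq p q hp hq p' q' hd
  obtain ⟨i₀⟩ : Nonempty ι := by
    rw [← Set.range_nonempty_iff_nonempty (f := p), ← affineSpan_nonempty (k := ℝ), hp]
    exact Set.univ_nonempty
  obtain ⟨j₀⟩ : Nonempty κ := by
    rw [← Set.range_nonempty_iff_nonempty (f := q), ← affineSpan_nonempty (k := ℝ), hq]
    exact Set.univ_nonempty
  have hBinj : ∀ x, B x = 0 → x = 0 := fun x hx => by
    have := hBN x x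
    rw [hx, inner_zero_left] at this
    exact inner_self_eq_zero.1 this.symm
  let M : E →ₗ[ℝ] E := B.adjoint ∘ₗ B
  have hM : ∀ x y, inner ℝ (M x) y = inner ℝ (B x) (B y) := fun x y => by
    simp [M, LinearMap.adjoint_inner_left]
  have hMN : ∀ x, M (N x) = x := fun x => ext_inner_right ℝ fun y => by
    rw [hM, real_inner_comm, hBN, real_inner_comm]
  have hN : ∀ x y, inner ℝ (N x) y = inner ℝ (B (N x)) (B (N y)) := fun x y => by
    rw [hBN]
  let r : E → ℝ := fun x => ‖B (x + t - N x)‖ ^ 2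
  let f : E → ℝ := fun x => ‖B (x + t)‖ ^ 2 - ‖x‖ ^ 2
  let g : E → ℝ := fun x => ‖B (N x)‖ ^ 2 - 2 * inner ℝ t x - ‖x‖ ^ 2
  have hfg : ∀ x, f x + g x = r x := by
    intro x
    simp only [f, g, r]
    rw [map_sub, norm_sub_sq_real, hBN, inner_add_left, real_inner_self_eq_norm_sq]
    ring
  have hdist : ∀ i j, f (p i) + ‖γ i‖ ^ 2 + (g (q j) + ‖e j‖ ^ 2) = 0 := by
    intro i j
    have h1 := congrArg (· ^ 2) (hd i j)
    have h2 : p' i - q' j = (B (p i + t) - B (N (q j))) + (γ i - e j) := by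
      rw [hp', hq']; abel
    have h3 : inner ℝ (B (p i + t) - B (N (q j))) (γ i - e j) = 0 := by
      rw [← map_sub, inner_sub_right, hBc, hBe, sub_zero]
    simp only [dist_eq_norm] at h1
    rw [h2, norm_add_sq_real, h3, norm_sub_sq_real (γ i), hce, norm_sub_sq_real, hBN,
      norm_sub_sq_real, inner_add_left] at h1
    simp only [f, g]
    linarith
  -- In `hdist` the variables `i` and `j` separate, so each side is constant.
  let lam : ℝ := f (p i₀) + ‖γ i₀‖ ^ 2
  have hlam_q : ∀ j, g (q j) + ‖e j‖ ^ 2 = -lam := fun j => by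
    have := hdist i₀ j
    simp only [lam]
    linarith
  have hlam_p : ∀ i, f (p i) + ‖γ i‖ ^ 2 = lam := fun i => by
    have := hdist i j₀
    have := hlam_q j₀
    linarith
  let A : E →ₗ[ℝ] E := N - M
  let b : E := -(t + M t)
  let c : ℝ := 2 * lam - ‖B t‖ ^ 2
  have hA : A.IsSymmetric := fun x y => by
    simp only [A, LinearMap.sub_apply, inner_sub_left, inner_sub_right]
    rw [hN, hM, real_inner_comm (N y), real_inner_comm (M y), hN, hM, real_inner_comm (B x),
      real_inner_comm (B (N x))]
  have hQ : ∀ x, inner ℝ (A x) x + 2 * inner ℝ b x + c = g x - f x + 2 * lam := by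
    intro x
    simp only [A, b, c, f, g, LinearMap.sub_apply, inner_sub_left, inner_neg_left,
      inner_add_left, hM]
    rw [hN, real_inner_self_eq_norm_sq, real_inner_self_eq_norm_sq, map_add, norm_add_sq_real,
      real_inner_comm (B x)]
    ring
  have hQp : ∀ i, inner ℝ (A (p i)) (p i) + 2 * inner ℝ b (p i) + c =
      r (p i) + 2 * ‖γ i‖ ^ 2 := fun i => by
    rw [hQ, ← hfg, ← hlam_p i]
    ring
  have hQq : ∀ j, inner ℝ (A (q j)) (q j) + 2 * inner ℝ b (q j) + c =
      -(r (q j) + 2 * ‖e j‖ ^ 2) := fun j => by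
    rw [hQ, ← hfg]
    linarith [hlam_q j]
  have hr : ∀ x, 0 ≤ r x := fun x => sq_nonneg _
  have hr0 : ∀ x, r x = 0 → N x = x + t := fun x hx =>
    (sub_eq_zero.1 (hBinj _ (norm_eq_zero.1 (pow_eq_zero_iff two_ne_zero |>.1 hx)))).symm
  -- Applying `M = N⁻¹` to `N x = x + t` gives `x = M x + M t`, which is `A x + b = 0`.
  have hsing : ∀ x, r x = 0 → inner ℝ (A x) x + 2 * inner ℝ b x + c = 0 →
      A x + b = 0 ∧ inner ℝ b x + c = 0 := by
    intro x hx hQx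
    have h1 := hr0 x hx
    have h2 : A x + b = 0 := by
      have h3 := hMN x
      rw [h1, map_add] at h3
      simp only [A, b, LinearMap.sub_apply, h1]
      rw [show x + t - M x + -(t + M t) = x - (M x + M t) by abel, h3, sub_self]
    refine ⟨h2, ?_⟩
    have h4 : inner ℝ (A x + b) x = 0 := by rw [h2, inner_zero_left]
    rw [inner_add_left] at h4
    linarith
  obtain ⟨hzp, hzq⟩ := hpq A b c hA
    (fun i => by
      by_cases h : inner ℝ (A (p i)) (p i) + 2 * inner ℝ b (p i) + c = 0
      · refine Or.inr (hsing _ ?_ h)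
        rw [hQp] at h
        nlinarith [hr (p i), sq_nonneg ‖γ i‖]
      · refine Or.inl (lt_of_le_of_ne ?_ (Ne.symm h))
        rw [hQp]
        nlinarith [hr (p i), sq_nonneg ‖γ i‖])
    (fun j => by
      by_cases h : inner ℝ (A (q j)) (q j) + 2 * inner ℝ b (q j) + c = 0
      · refine Or.inr (hsing _ ?_ h)
        rw [hQq] at h
        nlinarith [hr (q j), sq_nonneg ‖e j‖]
      · refine Or.inl (lt_of_le_of_ne ?_ h)
        rw [hQq]
        nlinarith [hr (q j), sq_nonneg ‖e j‖])
  have hγ : ∀ i, γ i = 0 := fun i => by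
    have h := hzp i
    rw [hQp] at h
    exact norm_eq_zero.1 (pow_eq_zero_iff two_ne_zero |>.1
      (by nlinarith [hr (p i), sq_nonneg ‖γ i‖]))
  have he : ∀ j, e j = 0 := fun j => by
    have h := hzq j
    rw [hQq] at h
    exact norm_eq_zero.1 (pow_eq_zero_iff two_ne_zero |>.1
      (by nlinarith [hr (q j), sq_nonneg ‖e j‖]))
  have hNp : ∀ i, N (p i) = p i + t := fun i => hr0 _ (by
    have h := hzp i
    rw [hQp] at h
    nlinarith [hr (p i), sq_nonneg ‖γ i‖])
  -- Two affine maps agree on the affinely spanning `p`; linearity of `N` at `0` then gives `t = 0`.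
  have hNall : ∀ x, N x = x + t := by
    intro x
    have hx : x ∈ affineSpan ℝ (Set.range p) := by rw [hp]; trivial
    refine affineSpan_induction hx (Set.forall_mem_range.2 hNp) fun k y z v hy hz hv => ?_
    simp only [vsub_eq_sub, vadd_eq_add, map_add, map_smul, map_sub, hy, hz, hv,
      add_sub_add_right_eq_sub]
    abel
  have ht : t = 0 := by simpa using (hNall 0).symm
  have hdistB : ∀ x y, dist (o + B x) (o + B y) = dist x y := by
    intro x y
    rw [dist_add_left, dist_eq_norm, dist_eq_norm, ← map_sub, ← sq_eq_sq₀ (norm_nonneg _)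
      (norm_nonneg _), ← real_inner_self_eq_norm_sq, ← real_inner_self_eq_norm_sq, ← hBN,
      hNall, ht, add_zero]
  rw [congruent_iff_dist_eq]
  have h1 : ∀ s : ι ⊕ κ, Sum.elim p' q' s = o + B (Sum.elim p q s) := by
    rintro (i | j)
    · simp [hp', hγ, ht]
    · simp [hq', he, hNall, ht]
  intro s s'
  rw [h1, h1, hdistB]

/-! ### From the cone to quadric inseparability -/

theorem UniversallyRigid.congruent_of_finiteDimensional {V F : Type*} {d : ℕ} {G : SimpleGraph V}
    {p : V → EuclideanSpace ℝ (Fin d)} (h : UniversallyRigid G p)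
    [NormedAddCommGroup F] [InnerProductSpace ℝ F] [FiniteDimensional ℝ F] (p' : V → F)
    (hp' : ∀ i j, G.Adj i j → dist (p' i) (p' j) = dist (p i) (p j)) : Congruent p' p := by
  let φ := (stdOrthonormalBasis ℝ F).repr
  have := h _ (fun v => φ (p' v)) fun i j hij => by rw [φ.dist_map, hp' i j hij]
  intro i j
  rw [← this i j, φ.edist_map]

/-- The inclusion of `ℝ^d` in `ℝ^(d+1)` as a linear map. -/
def inclSuccLinear (d : ℕ) : EuclideanSpace ℝ (Fin d) →ₗ[ℝ] EuclideanSpace ℝ (Fin (d + 1)) where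
  toFun := inclSucc
  map_add' x y := by
    ext i
    refine Fin.lastCases ?_ (fun i => ?_) i <;> simp [inclSucc]
  map_smul' r x := by
    ext i
    refine Fin.lastCases ?_ (fun i => ?_) i <;> simp [inclSucc]

/-- Affine coordinates with respect to a cone point `p₀`: there are linear maps recovering from
`inclSucc x - p₀` the point `x` and the constant `1`. -/
theorem exists_cone_coordinates {d : ℕ} (p₀ : EuclideanSpace ℝ (Fin (d + 1)))
    (hp₀ : p₀ ∉ Set.range (inclSucc (d := d))) :
    ∃ (L : EuclideanSpace ℝ (Fin (d + 1)) →ₗ[ℝ] EuclideanSpace ℝ (Fin d))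
      (η : EuclideanSpace ℝ (Fin (d + 1))), ∀ x,
      L (inclSucc x - p₀) = x ∧ inner ℝ η (inclSucc x - p₀) = 1 := by
  have hlast : p₀ (Fin.last d) ≠ 0 := by
    intro h
    refine hp₀ ⟨WithLp.toLp 2 fun i => p₀ i.castSucc, ?_⟩
    ext i
    refine Fin.lastCases ?_ (fun i => ?_) i <;> simp [inclSucc, h]
  -- `L` projects along `p₀` onto the hyperplane, so it sends `inclSucc x - p₀` to `x`.
  let L : EuclideanSpace ℝ (Fin (d + 1)) →ₗ[ℝ] EuclideanSpace ℝ (Fin d) :=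
    { toFun := fun u => WithLp.toLp 2 fun i =>
        u i.castSucc - u (Fin.last d) / p₀ (Fin.last d) * p₀ i.castSucc
      map_add' := fun u v => by
        ext i
        simp
        ring
      map_smul' := fun r u => by
        ext i
        simp
        ring }
  refine ⟨L, EuclideanSpace.single (Fin.last d) (-(p₀ (Fin.last d))⁻¹), fun x => ⟨?_, ?_⟩⟩
  · ext i
    simp [L, inclSucc, hlast]
  · rw [EuclideanSpace.inner_single_left]
    simp [inclSucc, hlast]

theorem exists_cone_combination {d : ℕ} {ι : Type*} [Fintype ι]
    (p : ι → EuclideanSpace ℝ (Fin d)) (hp : affineSpan ℝ (Set.range p) = ⊤)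
    (p₀ : EuclideanSpace ℝ (Fin (d + 1))) (x : EuclideanSpace ℝ (Fin d)) :
    ∃ a : ι → ℝ, inclSucc x - p₀ = ∑ i, a i • (inclSucc (p i) - p₀) := by
  obtain ⟨a, ha, hx⟩ := eq_affineCombination_of_mem_affineSpan_of_fintype
    (show x ∈ affineSpan ℝ (Set.range p) by rw [hp]; trivial)
  refine ⟨a, ?_⟩
  rw [Finset.affineCombination_eq_linear_combination _ _ _ ha] at hx
  have h1 : inclSucc x = ∑ i, a i • inclSucc (p i) := by
    have := congrArg (inclSuccLinear d) hx
    rw [map_sum] at this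
    simp only [map_smul] at this
    exact this
  simp only [smul_sub, Finset.sum_sub_distrib, ← Finset.sum_smul, ha, one_smul, h1]

theorem quadricInseparable_of_cone_universallyRigid {d : ℕ} {ι κ : Type} [Fintype ι] [Fintype κ]
    (p : ι → EuclideanSpace ℝ (Fin d)) (q : κ → EuclideanSpace ℝ (Fin d))
    (hp : affineSpan ℝ (Set.range p) = ⊤) (hq : affineSpan ℝ (Set.range q) = ⊤)
    (p₀ : EuclideanSpace ℝ (Fin (d + 1)))
    (hp₀ : p₀ ∉ Set.range (inclSucc (d := d)))
    (hcone : UniversallyRigid (coneGraph (completeBipartiteGraph ι κ))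
      (coneConfig p₀ (Sum.elim p q))) :
    QuadricInseparable p q := by
  classical
  obtain ⟨L, η, hL⟩ := exists_cone_coordinates p₀ hp₀
  intro A b c hA hposp hnegq
  -- The homogenization of `Q`: `L u` plays the point and `⟪η, u⟫` the homogenizing variable.
  -- Singular points of `Q` land in the kernel of `X`.
  let X : EuclideanSpace ℝ (Fin (d + 1)) →ₗ[ℝ] EuclideanSpace ℝ (Fin (d + 1)) :=
    L.adjoint ∘ₗ (A ∘ₗ L + (innerₗ _ η).smulRight b) +
      (innerₗ _ b ∘ₗ L + c • innerₗ _ η).smulRight η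
  have hXapply : ∀ u, X u = L.adjoint (A (L u) + inner ℝ η u • b) +
      (inner ℝ b (L u) + c * inner ℝ η u) • η := fun u => by simp [X]
  have hXinner : ∀ u v, inner ℝ (X u) v = inner ℝ (A (L u)) (L v) +
      inner ℝ η u * inner ℝ b (L v) + (inner ℝ b (L u) + c * inner ℝ η u) * inner ℝ η v := by
    intro u v
    rw [hXapply, inner_add_left, LinearMap.adjoint_inner_left, inner_add_left,
      real_inner_smul_left, real_inner_smul_left]
  have hXsymm : X.IsSymmetric := fun u v => by
    rw [real_inner_comm (X v), hXinner, hXinner, hA, real_inner_comm (A (L v))]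
    ring
  have hXQ : ∀ x, inner ℝ (X (inclSucc x - p₀)) (inclSucc x - p₀) =
      inner ℝ (A x) x + 2 * inner ℝ b x + c := fun x => by
    rw [hXinner, (hL x).1, (hL x).2]
    ring
  have hXsing : ∀ x, A x + b = 0 ∧ inner ℝ b x + c = 0 → X (inclSucc x - p₀) = 0 := by
    rintro x ⟨h1, h2⟩
    rw [hXapply, (hL x).1, (hL x).2, one_smul, mul_one, h1, h2]
    simp
  have hXq : ∀ j, X (inclSucc (q j) - p₀) = 0 := by
    intro j
    obtain ⟨a, ha⟩ := exists_cone_combination p hp p₀ (q j)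
    refine apply_eq_zero_of_gram_rigid (fun i => inclSucc (p i) - p₀)
      (fun j => inclSucc (q j) - p₀) ?_ X.toContinuousLinearMap hXsymm
      (fun i => (hposp i).imp (fun h => (hXQ (p i)).symm ▸ h) (hXsing _))
      (fun j => (hnegq j).imp (fun h => (hXQ (q j)).symm ▸ h) (hXsing _)) j a ha
    intro F _ _ _ u' w' hu' hw' huw
    -- With the cone vertex at `0`, cone edges prescribe the norms and bipartite edges the mixed
    -- inner products.
    let P : Option (ι ⊕ κ) → F
      | none => 0
      | some s => Sum.elim u' w' s
    have hvec : ∀ x y : EuclideanSpace ℝ (Fin d), dist (inclSucc x) (inclSucc y) =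
        dist (inclSucc x - p₀) (inclSucc y - p₀) := fun x y => (dist_sub_right _ _ _).symm
    have huw_dist : ∀ i j, dist (u' i) (w' j) = dist (inclSucc (p i)) (inclSucc (q j)) := by
      intro i j
      rw [hvec, dist_eq_norm, dist_eq_norm, ← sq_eq_sq₀ (norm_nonneg _) (norm_nonneg _),
        norm_sub_sq_real, norm_sub_sq_real (inclSucc (p i) - p₀), hu', hw', huw]
    have hP := hcone.congruent_of_finiteDimensional P (by
      rintro (_ | i | j) (_ | k | l) h
      · exact h.elim
      · simpa [P, coneConfig, dist_eq_norm, norm_sub_rev] using hu' k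
      · simpa [P, coneConfig, dist_eq_norm, norm_sub_rev] using hw' l
      · simpa [P, coneConfig, dist_eq_norm] using hu' i
      · simp [coneGraph] at h
      · exact huw_dist i l
      · simpa [P, coneConfig, dist_eq_norm] using hw' j
      · rw [dist_comm, dist_comm (coneConfig _ _ _)]
        exact huw_dist k j
      · simp [coneGraph] at h)
    intro i k
    have h1 : dist (u' i) (u' k) = dist (inclSucc (p i)) (inclSucc (p k)) :=
      hP.dist_eq (some (Sum.inl i)) (some (Sum.inl k))
    rw [hvec, dist_eq_norm, dist_eq_norm, ← sq_eq_sq₀ (norm_nonneg _) (norm_nonneg _),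
      norm_sub_sq_real, norm_sub_sq_real (inclSucc (p i) - p₀), hu', hu'] at h1
    linarith
  -- The vectors to `q` span those to `p`, so the Gram argument is needed on one side only.
  have hXp : ∀ i, X (inclSucc (p i) - p₀) = 0 := fun i => by
    obtain ⟨a, ha⟩ := exists_cone_combination q hq p₀ (p i)
    rw [ha, map_sum]
    simp [hXq]
  exact ⟨fun i => by rw [← hXQ, hXp, inner_zero_left],
    fun j => by rw [← hXQ, hXq, inner_zero_left]⟩

theorem mainTheorem7 (d n m : ℕ)
    (p : Fin n → EuclideanSpace ℝ (Fin d)) (q : Fin m → EuclideanSpace ℝ (Fin d))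
    (hp : affineSpan ℝ (Set.range p) = ⊤) (hq : affineSpan ℝ (Set.range q) = ⊤)
    (p₀ : EuclideanSpace ℝ (Fin (d + 1)))
    (hp₀ : p₀ ∉ Set.range (inclSucc (d := d)))
    (hcone : UniversallyRigid (coneGraph (completeBipartiteGraph (Fin n) (Fin m)))
      (coneConfig p₀ (Sum.elim p q))) :
    UniversallyRigid (completeBipartiteGraph (Fin n) (Fin m)) (Sum.elim p q) := by
  intro D p' hp'
  have := (quadricInseparable_of_cone_universallyRigid p q hp hq p₀ hp₀ hcone).congruent hp hq
    (p' := p' ∘ Sum.inl) (q' := p' ∘ Sum.inr) fun i j => hp' _ _ (by simp)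
  rwa [Sum.elim_comp_inl_inr] at this
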